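/- Let $n,m\in\mathbb{N}$ and $T>0$. Let $f=([f]_i)_{i\le n}$ and $g=([g]_{ij})_{i\le n,\,j\le m}$ have entries that are real polynomials in $(t,x)\in\mathbb{R}\times\mathbb{R}^n$, and let $$X=\{x\in\mathbb{R}^n: h_{X_i}(x)\ge 0,\ i=1,\dots,n_X\},\qquad X_T=\{x\in\mathbb{R}^n: h_{T_i}(x)\ge 0,\ i=1,\dots,n_T\}$$ with real polynomials $h_{X_i},h_{T_i}$. Assume that $X$ and $X_T$ are compact. Let $\lambda$ be the Lebesgue measure on $X$. By a $C^1$ test function we mean a continuously differentiable function $v:\mathbb{R}\times\mathbb{R}^n\to\mathbb{R}$ (this is how elements of $C^1([0,T]\times X)$ are given); put $$\mathcal{L}_f v=\frac{\partial v}{\partial t}+\sum_{i=1}^n\frac{\partial v}{\partial x_i}[f]_i,\qquad [\mathcal{L}_g v]_j=\sum_{i=1}^n\frac{\partial v}{\partial x_i}[g]_{ij}\quad(j=1,\dots,m).$$ Let $P$ be the problem of maximizing $\mu_0(X)$ over all tuples $(\sigma^+,\sigma^-,\hat\sigma,\mu,\mu_0,\hat\mu_0,\mu_T)$ of nonnegative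 finite Borel measures, where $[\sigma^+]_j,[\sigma^-]_j,[\hat\sigma]_j$ ($j=1,\dots,m$) and $\mu$ are measures on $[0,T]\times X$, $\mu_0,\hat\mu_0$ are measures on $X$ and $\mu_T$ is a measure on $X_T$, such that $$\int \mathcal{L}_f v\,d\mu+\sum_{j=1}^m\Big(\int[\mathcal{L}_g v]_j\,d[\sigma^+]_j-\int[\mathcal{L}_g v]_j\,d[\sigma^-]_j\Big)=\int_{X_T}v(T,x)\,d\mu_T(x)-\int_X v(0,x)\,d\mu_0(x)$$ for every $C^1$ test function $v$, $[\sigma^+]_j+[\sigma^-]_j+[\hat\sigma]_j=\mu$ for every $j$, and $\mu_0+\hat\mu_0=\lambda$. Let $D$ be the problem of minimizing $\int_X w\,d\lambda$ over all $C^1$ test functions $v$, all $w\in C(X)$ and all $p\in C([0,T]\times X)^m$ such that, on $[0,T]\times X$, $\mathcal{L}_f v+\sum_{i=1}^m[p]_i\le 0$ and $[p]_i\ge 0$, $[p]_i\ge|[\mathcal{L}_g v]_i|$ for every $i$; on $X$, $w\ge 0$ and $w(x)\ge v(0,x)+1$; and $v(T,x)\ge 0$ for every $x\in X_T$. Then there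 is no duality gap between $P$ and $D$: the supremum of $P$ equals the infimum of $D$ (as extended real numbers). -/

import Mathlib

open MeasureTheory

/-- The data of the two linear programs: a final time `T`, a control-affine system
`x' = f(t,x) + g(t,x) u` on `ℝⁿ` with `m` inputs and polynomial `f`, `g`, and the polynomials that
describe the bounding set and the target set.  In a polynomial with variables `Fin (n + 1)`,
variable `0` is time and variable `i + 1` is the `i`-th coordinate of the state. -/
structure ControlAffineData (n m : ℕ) where
  /-- the final time -/
  T : ℝ
  /-- the components of the drift `f(t,x)` -/
  f : Fin n → MvPolynomial (Fin (n + 1)) ℝ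
  /-- the entries of the input matrix `g(t,x)` -/
  g : Matrix (Fin n) (Fin m) (MvPolynomial (Fin (n + 1)) ℝ)
  /-- the number of polynomials describing the bounding set -/
  nX : ℕ
  /-- the polynomials describing the bounding set -/
  hX : Fin nX → MvPolynomial (Fin n) ℝ
  /-- the number of polynomials describing the target set -/
  nT : ℕ
  /-- the polynomials describing the target set -/
  hT : Fin nT → MvPolynomial (Fin n) ℝ

namespace ControlAffineData

variable {n m : ℕ} (S : ControlAffineData n m)

/-- The bounding set `X = {x | h_{X_i}(x) ≥ 0 for all i}`. -/
def X : Set (Fin n → ℝ) := {x | ∀ i, 0 ≤ MvPolynomial.eval x (S.hX i)}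

/-- The target set `X_T = {x | h_{T_i}(x) ≥ 0 for all i}`. -/
def XT : Set (Fin n → ℝ) := {x | ∀ i, 0 ≤ MvPolynomial.eval x (S.hT i)}

/-- The set `[0,T] × X`. -/
def TX : Set (ℝ × (Fin n → ℝ)) := Set.Icc 0 S.T ×ˢ S.X

/-- `(L_f v)(t,x) = ∂v/∂t + ∑ i, ∂v/∂x_i * [f]_i(t,x)`. -/
noncomputable def Lf (v : ℝ × (Fin n → ℝ) → ℝ) (z : ℝ × (Fin n → ℝ)) : ℝ :=
  fderiv ℝ v z (1, 0) +
    ∑ i, fderiv ℝ v z (0, Pi.single i 1) *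
      MvPolynomial.eval (Fin.cons z.1 z.2 : Fin (n + 1) → ℝ) (S.f i)

/-- `[L_g v]_j(t,x) = ∑ i, ∂v/∂x_i * [g]_{ij}(t,x)`. -/
noncomputable def Lg (v : ℝ × (Fin n → ℝ) → ℝ) (j : Fin m) (z : ℝ × (Fin n → ℝ)) : ℝ :=
  ∑ i, fderiv ℝ v z (0, Pi.single i 1) *
    MvPolynomial.eval (Fin.cons z.1 z.2 : Fin (n + 1) → ℝ) (S.g i j)

/-- The decision variables of `P`: tuples of nonnegative (finite Borel) measures
`(σ⁺, σ⁻, σ̂, μ, μ₀, μ̂₀, μ_T)`. -/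
structure PrimalVar where
  σp : Fin m → FiniteMeasure S.TX
  σm : Fin m → FiniteMeasure S.TX
  σh : Fin m → FiniteMeasure S.TX
  μ : FiniteMeasure S.TX
  μ₀ : FiniteMeasure S.X
  μh₀ : FiniteMeasure S.X
  μT : FiniteMeasure S.XT

/-- The decision variables `(v, w, p)` of `D`.  A function in `C¹([0,T] × X)` is given by a
`C¹` function on `ℝ × ℝⁿ`. -/
structure DualVar where
  v : ℝ × (Fin n → ℝ) → ℝ
  v_contDiff : ContDiff ℝ 1 v
  w : C(S.X, ℝ)
  p : Fin m → C(S.TX, ℝ)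

variable {S}

/-- Liouville's equation
`L_f' μ + L_g' (σ⁺ - σ⁻) = δ_T ⊗ μ_T - δ_0 ⊗ μ₀` between linear functionals on `C¹` functions. -/
def PrimalVar.Liouville (q : S.PrimalVar) : Prop :=
  ∀ v : ℝ × (Fin n → ℝ) → ℝ, ContDiff ℝ 1 v →
    (∫ z, S.Lf v z.1 ∂(q.μ : Measure S.TX)) +
      ∑ j, ((∫ z, S.Lg v j z.1 ∂(q.σp j : Measure S.TX)) -
        ∫ z, S.Lg v j z.1 ∂(q.σm j : Measure S.TX)) =
    (∫ x, v (S.T, x.1) ∂(q.μT : Measure S.XT)) - ∫ x, v (0, x.1) ∂(q.μ₀ : Measure S.X)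

/-- Feasibility for `P`. -/
structure PrimalVar.Feasible (q : S.PrimalVar) : Prop where
  liouville : q.Liouville
  control : ∀ j, q.σp j + q.σm j + q.σh j = q.μ
  lebesgue : (q.μ₀ : Measure S.X) + (q.μh₀ : Measure S.X) =
    (volume : Measure (Fin n → ℝ)).comap Subtype.val

/-- Feasibility for `D`. -/
structure DualVar.Feasible (y : S.DualVar) : Prop where
  decrease : ∀ z : S.TX, S.Lf y.v z.1 + ∑ i, y.p i z ≤ 0
  p_nonneg : ∀ i, ∀ z : S.TX, 0 ≤ y.p i z
  p_bound : ∀ i, ∀ z : S.TX, |S.Lg y.v i z.1| ≤ y.p i z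
  w_nonneg : ∀ x : S.X, 0 ≤ y.w x
  w_initial : ∀ x : S.X, y.v (0, x.1) + 1 ≤ y.w x
  v_final : ∀ x : S.XT, 0 ≤ y.v (S.T, x.1)

variable (S)

/-- The optimal value of `P`: the supremum of `μ₀(X)` over all feasible tuples. -/
noncomputable def primalValue : EReal :=
  ⨆ q : {q : S.PrimalVar // q.Feasible}, (((q.1.μ₀ : Measure S.X).real Set.univ : ℝ) : EReal)

/-- The optimal value of `D`: the infimum of `∫_X w dλ` over all feasible `(v, w, p)`. -/
noncomputable def dualValue : EReal :=
  ⨅ y : {y : S.DualVar // y.Feasible},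
    ((∫ x, y.1.w x ∂((volume : Measure (Fin n → ℝ)).comap Subtype.val) : ℝ) : EReal)

end ControlAffineData

/-!
Linear programming duality, with the supremum of the measure program attained.

Weak duality is obtained by testing Liouville's equation against a dual feasible `v`
(`ControlAffineData.weak_duality`).

For the converse, the dual program is written as: minimise a linear functional `c y` over the `y` in
a vector space of triples `(v, w, p)` with `G y + b ≥ 0`, where `G` takes values in a finite product
of spaces of continuous functions on compact sets.  The function
`v(t,x) = K ((m + 1) (T - t) + 1)` together with `p = K` and a large constant `w` makes every
component of `G y` at least `K`, so the range of `G` meets every translate of the positive cone.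
M. Riesz's extension theorem then yields a positive functional `Λ` with `Λ (G y) = c y` and
`Λ b = -d`, where `d` is the optimal dual value (`exists_dual_multiplier`).  By the
Riesz–Markov–Kakutani theorem, the components of `Λ` are integrals against finite measures.
Reading `Λ ∘ G = c` at `v`, `w` and `p` separately gives Liouville's equation, the splitting of the
Lebesgue measure and the control constraint, and `Λ b = -d` says that `μ₀` has mass `d`
(`ControlAffineData.exists_feasible_mass_eq`).  So no compactness of the set of feasible measures is
needed.
-/

/-! ### Positive functionals and conic duality -/

section Conic

variable {W Y E : Type*} [AddCommGroup W] [Module ℝ W] [AddCommGroup Y] [Module ℝ Y]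
  [AddCommGroup E] [PartialOrder E] [IsOrderedAddMonoid E] [Module ℝ E] [PosSMulMono ℝ E]

/-- If the range of `A` meets every translate of the positive cone, then a functional `φ` that is
nonnegative wherever `A` is factors through `A` by a positive functional. -/
lemma exists_positive_functional_comp_eq (A : W →ₗ[ℝ] E) (φ : W →ₗ[ℝ] ℝ)
    (nonneg : ∀ w, 0 ≤ A w → 0 ≤ φ w) (dense : ∀ e, ∃ w, 0 ≤ A w + e) :
    ∃ Λ : E →ₗ[ℝ] ℝ, (∀ e, 0 ≤ e → 0 ≤ Λ e) ∧ ∀ w, Λ (A w) = φ w := by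
  -- Extending from `W × 0` inside `W × E`, rather than from the range of `A`, avoids having to
  -- check that `φ` descends to that range.
  let s : PointedCone ℝ (W × E) :=
    { carrier := {z | 0 ≤ A z.1 + z.2}
      add_mem' := by
        intro a b ha hb
        simp only [Set.mem_ofPred_eq, Prod.fst_add, Prod.snd_add, map_add] at ha hb ⊢
        have := add_nonneg ha hb
        convert this using 1; abel
      zero_mem' := by simp
      smul_mem' := by
        intro k a ha
        have : 0 ≤ (k : ℝ) • (A a.1 + a.2) := smul_nonneg k.2 ha
        have h2 : A (k • a).1 + (k • a).2 = (k : ℝ) • (A a.1 + a.2) := by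
          rw [smul_add, ← map_smul]; rfl
        simpa only [Set.mem_ofPred_eq, h2] using this }
  let D : Submodule ℝ (W × E) := LinearMap.range (LinearMap.inl ℝ W E)
  obtain ⟨g, hg, hpos⟩ := riesz_extension s
    ⟨D, (φ.comp (LinearMap.fst ℝ W E)).domRestrict D⟩
    (by
      rintro ⟨_, w, rfl⟩ h
      have h' : 0 ≤ A w + 0 := h
      exact nonneg w (by simpa using h'))
    (by
      rintro ⟨w, e⟩
      obtain ⟨w', hw'⟩ := dense e
      refine ⟨⟨(w' - w, 0), w' - w, rfl⟩, ?_⟩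
      change 0 ≤ A (w' - w + w) + (0 + e)
      simpa using hw')
  refine ⟨g.comp (LinearMap.inr ℝ W E), fun e he => hpos _ ?_, fun w => ?_⟩
  · change 0 ≤ A 0 + e
    simpa using he
  · -- `(-w, A w)` and its negative both lie in the cone.
    have h1 : 0 ≤ g (-w, A w) := hpos _ (by change 0 ≤ A (-w) + A w; simp)
    have h2 : 0 ≤ g (w, -A w) := hpos _ (by change 0 ≤ A w + -A w; simp)
    have h3 : g (w, 0) = φ w := hg ⟨(w, 0), w, rfl⟩
    have e1 : ((-w, A w) : W × E) = (0, A w) - (w, 0) := by simp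
    have e2 : ((w, -A w) : W × E) = (w, 0) - (0, A w) := by simp
    rw [e1, map_sub] at h1
    rw [e2, map_sub] at h2
    change g (0, A w) = φ w
    linarith

/-- Strong duality for a conic linear program: under a Slater-type condition, the optimal value `d`
of "minimise `c y` subject to `G y + b ≥ 0`" is attained by a positive multiplier. -/
lemma exists_dual_multiplier (G : Y →ₗ[ℝ] E) (b : E) (c : Y →ₗ[ℝ] ℝ) (d : ℝ)
    (hd : IsGLB (c '' {y | 0 ≤ G y + b}) d) (dense : ∀ e, ∃ y, 0 ≤ G y + e) :
    ∃ Λ : E →ₗ[ℝ] ℝ, (∀ e, 0 ≤ e → 0 ≤ Λ e) ∧ (∀ y, Λ (G y) = c y) ∧ Λ b = -d := by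
  have lower : ∀ y, 0 ≤ G y + b → d ≤ c y := fun y hy => hd.1 ⟨y, hy, rfl⟩
  obtain ⟨y₀, hy₀⟩ := dense b
  -- `c` is nonnegative on directions of recession of the feasible set.
  have recession : ∀ z, 0 ≤ G z → 0 ≤ c z := by
    intro z hz
    by_contra! hneg
    let k : ℝ := (|c y₀ - d| + 1) / (-c z)
    have hk : 0 ≤ k := div_nonneg (by positivity) (by linarith)
    have h := lower (y₀ + k • z) (by
      have := add_nonneg hy₀ (smul_nonneg hk hz)
      rw [map_add, map_smul]
      convert this using 1; abel)
    have hkz : k * c z = -(|c y₀ - d| + 1) := by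
      simp only [k]; rw [div_neg, neg_mul, div_mul_cancel₀ _ hneg.ne]
    rw [map_add, map_smul, smul_eq_mul, hkz] at h
    linarith [le_abs_self (c y₀ - d)]
  obtain ⟨Λ, hΛ, hΛA⟩ := exists_positive_functional_comp_eq
    (G.coprod (LinearMap.toSpanSingleton ℝ E b))
    (c.coprod (LinearMap.toSpanSingleton ℝ ℝ (-d)))
    (by
      rintro ⟨y, s⟩ h
      simp only [LinearMap.coprod_apply, LinearMap.toSpanSingleton_apply, smul_eq_mul] at h ⊢
      -- For `s < 0`, adding `-s` times a feasible `z` gives a direction of recession; for `s > 0`,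
      -- rescaling gives a feasible point.
      rcases lt_trichotomy s 0 with hs | rfl | hs
      · have : c y / s ≤ d := by
          refine hd.2 ?_
          rintro _ ⟨z, hz, rfl⟩
          have h1 := recession (y + (-s) • z) (by
            have := add_nonneg h (smul_nonneg (neg_pos.2 hs).le hz)
            rw [map_add, map_smul]
            convert this using 1
            module)
          rw [map_add, map_smul, smul_eq_mul] at h1
          rw [div_le_iff_of_neg hs]
          linarith
        rw [div_le_iff_of_neg hs] at this
        linarith
      · simpa using recession y (by simpa using h)
      · have h1 := lower (s⁻¹ • y) (by
          have := smul_nonneg (inv_pos.2 hs).le h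
          rwa [smul_add, smul_smul, inv_mul_cancel₀ hs.ne', one_smul, ← map_smul] at this)
        rw [map_smul, smul_eq_mul, ← div_eq_inv_mul, le_div_iff₀ hs] at h1
        linarith)
    (fun e => by
      obtain ⟨y, hy⟩ := dense e
      exact ⟨(y, 0), by simpa using hy⟩)
  refine ⟨Λ, hΛ, fun y => ?_, ?_⟩
  · simpa using hΛA (y, 0)
  · simpa using hΛA (0, 1)

end Conic

/-- A positive functional on a product is a sum of positive functionals on the factors. -/
lemma exists_positive_functional_prod {A B : Type*} [AddCommGroup A] [PartialOrder A] [Module ℝ A]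
    [AddCommGroup B] [PartialOrder B] [Module ℝ B]
    (Λ : A × B →ₗ[ℝ] ℝ) (hΛ : ∀ e, 0 ≤ e → 0 ≤ Λ e) :
    ∃ (Λ₁ : A →ₗ[ℝ] ℝ) (Λ₂ : B →ₗ[ℝ] ℝ), (∀ a, 0 ≤ a → 0 ≤ Λ₁ a) ∧ (∀ b, 0 ≤ b → 0 ≤ Λ₂ b) ∧
      ∀ a b, Λ (a, b) = Λ₁ a + Λ₂ b := by
  refine ⟨Λ.comp (LinearMap.inl ℝ A B), Λ.comp (LinearMap.inr ℝ A B),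
    fun a ha => hΛ _ ⟨ha, le_rfl⟩, fun b hb => hΛ _ ⟨le_rfl, hb⟩, fun a b => ?_⟩
  simp [← map_add]

/-! ### Representing measures -/

section Riesz

open MeasureTheory

variable {K : Type*} [TopologicalSpace K] [MeasurableSpace K] [BorelSpace K]

lemma integrable_continuousMap [CompactSpace K] (μ : Measure K) [IsFiniteMeasure μ] (f : C(K, ℝ)) :
    Integrable f μ :=
  f.continuous.integrable_of_hasCompactSupport (HasCompactSupport.of_compactSpace f)

lemma measure_ext_of_continuousMap [HasOuterApproxClosed K] {μ ν : Measure K} [IsFiniteMeasure μ]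
    [IsFiniteMeasure ν] (h : ∀ f : C(K, ℝ), ∫ x, f x ∂μ = ∫ x, f x ∂ν) : μ = ν :=
  ext_of_forall_integral_eq_of_IsFiniteMeasure fun f => h f.toContinuousMap

variable [T2Space K] [CompactSpace K]

/-- **Riesz–Markov–Kakutani** on a compact space, with the measure bundled as a finite measure. -/
lemma exists_finiteMeasure_integral_eq (Λ : C(K, ℝ) →ₗ[ℝ] ℝ) (hΛ : ∀ e, 0 ≤ e → 0 ≤ Λ e) :
    ∃ μ : FiniteMeasure K, ∀ f : C(K, ℝ), Λ f = ∫ x, f x ∂(μ : Measure K) := by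
  let Φ : CompactlySupportedContinuousMap K ℝ →ₗ[ℝ] ℝ :=
    { toFun := fun f => Λ f.toContinuousMap
      map_add' := fun f g => Λ.map_add f.toContinuousMap g.toContinuousMap
      map_smul' := fun k f => Λ.map_smul k f.toContinuousMap }
  let Ψ := PositiveLinearMap.mk₀ Φ (fun f hf => hΛ _ hf)
  refine ⟨⟨RealRMK.rieszMeasure Ψ, inferInstance⟩, fun f => ?_⟩
  exact (RealRMK.integral_rieszMeasure Ψ
    (CompactlySupportedContinuousMap.continuousMapEquiv f)).symm

lemma exists_finiteMeasure_sum_integral_eq {ι : Type*} [Fintype ι] [DecidableEq ι]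
    (Λ : (ι → C(K, ℝ)) →ₗ[ℝ] ℝ) (hΛ : ∀ e, 0 ≤ e → 0 ≤ Λ e) :
    ∃ μ : ι → FiniteMeasure K, ∀ f : ι → C(K, ℝ),
      Λ f = ∑ j, ∫ x, f j x ∂(μ j : Measure K) := by
  have h := fun j : ι => exists_finiteMeasure_integral_eq
    (Λ.comp (LinearMap.single ℝ (fun _ : ι => C(K, ℝ)) j))
    (fun e he => hΛ _ (by simpa using he))
  choose μ hμ using h
  refine ⟨μ, fun f => ?_⟩
  simp_rw [← hμ, LinearMap.comp_apply, LinearMap.coe_single, ← map_sum]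
  rw [Finset.univ_sum_single]

end Riesz

/-! ### The two linear programs -/

namespace ControlAffineData

open MeasureTheory

variable {n m : ℕ} (S : ControlAffineData n m)

lemma isClosed_X : IsClosed S.X := by
  simp only [X, Set.ofPred_forall]
  exact isClosed_iInter fun i => isClosed_le continuous_const (MvPolynomial.continuous_eval _)

lemma isFiniteMeasure_comap_volume (hX : IsCompact S.X) :
    IsFiniteMeasure ((volume : Measure (Fin n → ℝ)).comap (Subtype.val : S.X → Fin n → ℝ)) := by
  constructor
  rw [(MeasurableEmbedding.subtype_coe S.isClosed_X.measurableSet).comap_apply]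
  simpa using hX.measure_lt_top

lemma continuous_eval_cons (P : MvPolynomial (Fin (n + 1)) ℝ) :
    Continuous fun z : ℝ × (Fin n → ℝ) =>
      MvPolynomial.eval (Fin.cons z.1 z.2 : Fin (n + 1) → ℝ) P := by
  refine (MvPolynomial.continuous_eval P).comp (continuous_pi fun i => ?_)
  refine Fin.cases ?_ (fun j => ?_) i
  · simpa using continuous_fst
  · simp only [Fin.cons_succ]; fun_prop

lemma continuous_Lf {v : ℝ × (Fin n → ℝ) → ℝ} (hv : ContDiff ℝ 1 v) : Continuous (S.Lf v) := by
  have h := hv.continuous_fderiv one_ne_zero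
  unfold Lf
  exact (h.clm_apply continuous_const).add (continuous_finsetSum _ fun i _ =>
    (h.clm_apply continuous_const).mul (continuous_eval_cons _))

lemma continuous_Lg {v : ℝ × (Fin n → ℝ) → ℝ} (hv : ContDiff ℝ 1 v) (j : Fin m) :
    Continuous (S.Lg v j) := by
  have h := hv.continuous_fderiv one_ne_zero
  unfold Lg
  exact continuous_finsetSum _ fun i _ =>
    (h.clm_apply continuous_const).mul (continuous_eval_cons _)

/-- The space of `C¹` test functions on `ℝ × ℝⁿ`. -/
def testFunctions (n : ℕ) : Submodule ℝ (ℝ × (Fin n → ℝ) → ℝ) where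
  carrier := {v | ContDiff ℝ 1 v}
  add_mem' ha hb := by
    rw [Set.mem_ofPred_eq] at ha hb ⊢
    exact ha.add hb
  zero_mem' := by
    rw [Set.mem_ofPred_eq]
    exact contDiff_const
  smul_mem' k _ ha := by
    rw [Set.mem_ofPred_eq] at ha ⊢
    exact contDiff_const.smul ha

lemma mem_testFunctions {v : ℝ × (Fin n → ℝ) → ℝ} : v ∈ testFunctions n ↔ ContDiff ℝ 1 v :=
  Iff.rfl

lemma testFunctions.contDiff (v : testFunctions n) : ContDiff ℝ 1 v.1 :=
  mem_testFunctions.1 v.2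

lemma testFunctions.differentiable (v : testFunctions n) : Differentiable ℝ v.1 :=
  (testFunctions.contDiff v).differentiable one_ne_zero

lemma fderiv_add_testFunctions (v v' : testFunctions n) (z : ℝ × (Fin n → ℝ)) :
    fderiv ℝ (v + v' : testFunctions n).1 z = fderiv ℝ v.1 z + fderiv ℝ v'.1 z :=
  fderiv_add (testFunctions.differentiable v z)
    (testFunctions.differentiable v' z)

lemma fderiv_smul_testFunctions (k : ℝ) (v : testFunctions n) (z : ℝ × (Fin n → ℝ)) :
    fderiv ℝ (k • v : testFunctions n).1 z = k • fderiv ℝ v.1 z :=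
  fderiv_const_smul (testFunctions.differentiable v z) k

/-- `v ↦ L_f v`, restricted to `[0,T] × X`. -/
noncomputable def LfMap : testFunctions n →ₗ[ℝ] C(S.TX, ℝ) where
  toFun v := ⟨fun z => S.Lf v.1 z.1,
    (S.continuous_Lf (testFunctions.contDiff v)).comp continuous_subtype_val⟩
  map_add' v v' := by
    ext z
    simp only [ContinuousMap.coe_mk, ContinuousMap.add_apply, Lf, fderiv_add_testFunctions,
      add_apply, add_mul, Finset.sum_add_distrib]
    ring
  map_smul' k v := by
    ext z
    simp only [ContinuousMap.coe_mk, ContinuousMap.smul_apply, Lf, fderiv_smul_testFunctions,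
      smul_apply, smul_eq_mul, mul_assoc, ← Finset.mul_sum, RingHom.id_apply]
    ring

/-- `v ↦ [L_g v]_j`, restricted to `[0,T] × X`. -/
noncomputable def LgMap (j : Fin m) : testFunctions n →ₗ[ℝ] C(S.TX, ℝ) where
  toFun v := ⟨fun z => S.Lg v.1 j z.1,
    (S.continuous_Lg (testFunctions.contDiff v) j).comp continuous_subtype_val⟩
  map_add' v v' := by
    ext z
    simp only [ContinuousMap.coe_mk, ContinuousMap.add_apply, Lg, fderiv_add_testFunctions,
      add_apply, add_mul, Finset.sum_add_distrib]
  map_smul' k v := by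
    ext z
    simp only [ContinuousMap.coe_mk, ContinuousMap.smul_apply, Lg, fderiv_smul_testFunctions,
      smul_apply, smul_eq_mul, mul_assoc, ← Finset.mul_sum, RingHom.id_apply]

/-- Restriction of a test function to the time slice `{t} × A`. -/
def sliceMap (t : ℝ) (A : Set (Fin n → ℝ)) : testFunctions n →ₗ[ℝ] C(A, ℝ) where
  toFun v := ⟨fun x => v.1 (t, x.1), (testFunctions.contDiff v).continuous.comp
    (continuous_const.prodMk continuous_subtype_val)⟩
  map_add' _ _ := rfl
  map_smul' _ _ := rfl

@[simp] lemma LfMap_apply (v : testFunctions n) (z : S.TX) : S.LfMap v z = S.Lf v.1 z.1 := rfl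

@[simp] lemma LgMap_apply (j : Fin m) (v : testFunctions n) (z : S.TX) :
    S.LgMap j v z = S.Lg v.1 j z.1 := rfl

@[simp] lemma sliceMap_apply (t : ℝ) (A : Set (Fin n → ℝ)) (v : testFunctions n) (x : A) :
    sliceMap t A v x = v.1 (t, x.1) := rfl

/-- The vector space of triples `(v, w, p)`, without the constraints of the dual program. -/
abbrev DualSpace := testFunctions n × C(S.X, ℝ) × (Fin m → C(S.TX, ℝ))

/-- The space in which the constraints of the dual program take values.  The factors are paired
with the primal variables `μ, σ⁺, σ⁻, σ̂, μ̂₀, μ₀, μ_T`, in this order. -/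
abbrev ConstraintSpace :=
  C(S.TX, ℝ) × (Fin m → C(S.TX, ℝ)) × (Fin m → C(S.TX, ℝ)) × (Fin m → C(S.TX, ℝ)) ×
    C(S.X, ℝ) × C(S.X, ℝ) × C(S.XT, ℝ)

/-- The linear part of the constraints of the dual program:
`-(L_f v + ∑ p)`, `p - L_g v`, `p + L_g v`, `p`, `w`, `w - v(0,·)`, `v(T,·)`. -/
noncomputable def constraintMap : S.DualSpace →ₗ[ℝ] S.ConstraintSpace where
  toFun y :=
    (-(S.LfMap y.1 + ∑ j, y.2.2 j), fun j => y.2.2 j - S.LgMap j y.1,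
      fun j => y.2.2 j + S.LgMap j y.1, y.2.2, y.2.1, y.2.1 - sliceMap 0 S.X y.1,
      sliceMap S.T S.XT y.1)
  map_add' y y' := by
    simp only [Prod.fst_add, Prod.snd_add, map_add, Pi.add_apply, Finset.sum_add_distrib,
      Prod.mk_add_mk, Prod.mk.injEq, true_and, and_true]
    refine ⟨by abel, ?_, ?_, by abel⟩ <;> funext j <;> simp only [Pi.add_apply] <;> abel
  map_smul' k y := by
    simp only [Prod.smul_fst, Prod.smul_snd, map_smul, Pi.smul_apply, ← Finset.smul_sum,
      Prod.smul_mk, RingHom.id_apply, ← smul_add, ← smul_sub, ← smul_neg]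
    rfl

/-- The constant part of the constraints of the dual program; it comes from `w ≥ v(0,·) + 1`. -/
def constraintConst : S.ConstraintSpace := (0, 0, 0, 0, 0, -1, 0)

variable {S}

/-- A triple `(v, w, p)` as a dual variable. -/
def dualVarOf (y : S.DualSpace) : S.DualVar := ⟨y.1.1, testFunctions.contDiff y.1, y.2.1, y.2.2⟩

lemma feasible_of_constraint {y : S.DualSpace}
    (h : 0 ≤ S.constraintMap y + S.constraintConst) : (dualVarOf y).Feasible := by
  obtain ⟨h1, h2, h3, h4, h5, h6, h7⟩ := h
  refine ⟨fun z => ?_, fun i z => ?_, fun i z => abs_le.2 ⟨?_, ?_⟩, fun x => ?_, fun x => ?_,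
    fun x => ?_⟩
  · have := h1 z
    simp [constraintMap, constraintConst] at this
    simp [dualVarOf]
    linarith
  · have := h4 i z
    simp [constraintMap, constraintConst] at this
    exact this
  · have := h3 i z
    simp [constraintMap, constraintConst] at this
    simp [dualVarOf]
    linarith
  · have := h2 i z
    simp [constraintMap, constraintConst] at this
    simp [dualVarOf]
    linarith
  · have := h5 x
    simp [constraintMap, constraintConst] at this
    exact this
  · have := h6 x
    simp [constraintMap, constraintConst] at this
    simp [dualVarOf]
    linarith
  · have := h7 x
    simp [constraintMap, constraintConst] at this
    exact this

variable (S)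

/-- Every translate of the positive cone meets the range of the constraint map.  This is the Slater
condition that rules out a duality gap. -/
lemma exists_constraint_add_nonneg (hT : 0 < S.T) (hX : IsCompact S.X) (hXT : IsCompact S.XT)
    (e : S.ConstraintSpace) : ∃ y, 0 ≤ S.constraintMap y + e := by
  have : CompactSpace S.X := isCompact_iff_compactSpace.1 hX
  have : CompactSpace S.XT := isCompact_iff_compactSpace.1 hXT
  have : CompactSpace S.TX := isCompact_iff_compactSpace.1 (isCompact_Icc.prod hX)
  obtain ⟨K, hK⟩ : ∃ K : ℝ, K = ‖e‖ := ⟨_, rfl⟩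
  have hK0 : 0 ≤ K := hK ▸ norm_nonneg e
  obtain ⟨e1, e2, e3, e4, e5, e6, e7⟩ := e
  simp only [Prod.norm_mk] at hK
  have l1 : ‖e1‖ ≤ K := by simp [hK]
  have l2 : ‖e2‖ ≤ K := by simp [hK]
  have l3 : ‖e3‖ ≤ K := by simp [hK]
  have l4 : ‖e4‖ ≤ K := by simp [hK]
  have l5 : ‖e5‖ ≤ K := by simp [hK]
  have l6 : ‖e6‖ ≤ K := by simp [hK]
  have l7 : ‖e7‖ ≤ K := by simp [hK]
  have bd : ∀ {A : Type} [TopologicalSpace A] [CompactSpace A] (f : C(A, ℝ)), ‖f‖ ≤ K →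
      ∀ x, -K ≤ f x := fun f hf x =>
    (abs_le.1 ((f.norm_coe_le_norm x).trans hf)).1
  have bdp : ∀ (f : Fin m → C(S.TX, ℝ)), ‖f‖ ≤ K → ∀ j x, -K ≤ f j x := fun f hf j x =>
    bd (f j) ((norm_le_pi_norm f j).trans hf) x
  -- With this `v`, `L_f v = -K (m + 1)` and `L_g v = 0`, so `p = K` and the constant `w` below make
  -- every component of the constraint map at least `K`, which absorbs `e`.
  let v : ℝ × (Fin n → ℝ) → ℝ := fun z => K * ((m + 1) * (S.T - z.1) + 1)
  have hv : ContDiff ℝ 1 v := by fun_prop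
  have hfd : ∀ z, fderiv ℝ v z = (-(K * (m + 1))) • ContinuousLinearMap.fst ℝ ℝ (Fin n → ℝ) := by
    intro z
    refine HasFDerivAt.fderiv ?_
    have h := ((((hasFDerivAt_fst (𝕜 := ℝ) (p := z)).const_sub S.T).const_mul
      ((m : ℝ) + 1)).add_const 1).const_mul K
    refine h.congr_fderiv ?_
    module
  have hLf : ∀ z, S.Lf v z = -(K * (m + 1)) := by
    intro z; simp [Lf, hfd]
  have hLg : ∀ j z, S.Lg v j z = 0 := by
    intro j z; simp [Lg, hfd]
  have hTm : 0 ≤ K * ((m + 1) * S.T) := by positivity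
  refine ⟨(⟨v, hv⟩, ContinuousMap.const _ (K * ((m + 1) * S.T + 2)),
    fun _ => ContinuousMap.const _ K), ?_, ?_, ?_, ?_, ?_, ?_, ?_⟩
  · intro z
    have := bd e1 l1 z
    simp [constraintMap, hLf]
    linarith
  · intro j z
    have := bdp e2 l2 j z
    simp [constraintMap, hLg]
    linarith
  · intro j z
    have := bdp e3 l3 j z
    simp [constraintMap, hLg]
    linarith
  · intro j z
    have := bdp e4 l4 j z
    simp [constraintMap]
    linarith
  · intro x
    have := bd e5 l5 x
    simp [constraintMap]
    linarith
  · intro x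
    have := bd e6 l6 x
    simp [constraintMap, v]
    linarith
  · intro x
    have := bd e7 l7 x
    simp [constraintMap, v]
    linarith

variable {S}

/-! ### Weak duality -/

/-- Along a feasible pair, Liouville's equation and the decrease condition give
`∫ v(0,·) dμ₀ ≥ ∫ v(T,·) dμ_T ≥ 0`, so `μ₀(X) ≤ ∫ (v(0,·) + 1) dμ₀ ≤ ∫ w dμ₀ ≤ ∫ w dλ`. -/
lemma weak_duality (hX : IsCompact S.X) (hXT : IsCompact S.XT) {q : S.PrimalVar} (hq : q.Feasible)
    {y : S.DualVar} (hy : y.Feasible) :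
    (q.μ₀ : Measure S.X).real Set.univ ≤
      ∫ x, y.w x ∂((volume : Measure (Fin n → ℝ)).comap Subtype.val) := by
  have : CompactSpace S.X := isCompact_iff_compactSpace.1 hX
  have : CompactSpace S.XT := isCompact_iff_compactSpace.1 hXT
  have : CompactSpace S.TX := isCompact_iff_compactSpace.1 (isCompact_Icc.prod hX)
  let v : testFunctions n := ⟨y.v, y.v_contDiff⟩
  have hL := hq.liouville y.v y.v_contDiff
  have iTX : ∀ (μ : FiniteMeasure S.TX) (f : C(S.TX, ℝ)), Integrable f (μ : Measure S.TX) :=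
    fun μ f => integrable_continuousMap _ f
  have iX : ∀ (μ : FiniteMeasure S.X) (f : C(S.X, ℝ)), Integrable f (μ : Measure S.X) :=
    fun μ f => integrable_continuousMap _ f
  have hcontrol : ∀ j, (∫ z, S.Lg y.v j z.1 ∂(q.σp j : Measure S.TX)) -
      ∫ z, S.Lg y.v j z.1 ∂(q.σm j : Measure S.TX) ≤ ∫ z, y.p j z ∂(q.μ : Measure S.TX) := by
    intro j
    have h1 : ∫ z, S.Lg y.v j z.1 ∂(q.σp j : Measure S.TX) ≤
        ∫ z, y.p j z ∂(q.σp j : Measure S.TX) :=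
      integral_mono (iTX _ (S.LgMap j v)) (iTX _ _) fun z => (abs_le.1 (hy.p_bound j z)).2
    have h2 : ∫ z, -S.Lg y.v j z.1 ∂(q.σm j : Measure S.TX) ≤
        ∫ z, y.p j z ∂(q.σm j : Measure S.TX) :=
      integral_mono (iTX _ (-S.LgMap j v)) (iTX _ _) fun z =>
        neg_le.1 (abs_le.1 (hy.p_bound j z)).1
    have h3 : 0 ≤ ∫ z, y.p j z ∂(q.σh j : Measure S.TX) :=
      integral_nonneg fun z => hy.p_nonneg j z
    have h4 : ∫ z, y.p j z ∂(q.μ : Measure S.TX) = ∫ z, y.p j z ∂(q.σp j : Measure S.TX) +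
        ∫ z, y.p j z ∂(q.σm j : Measure S.TX) + ∫ z, y.p j z ∂(q.σh j : Measure S.TX) := by
      rw [← hq.control j, FiniteMeasure.toMeasure_add, FiniteMeasure.toMeasure_add,
        integral_add_measure ((iTX _ _).add_measure (iTX _ _)) (iTX _ _),
        integral_add_measure (iTX _ _) (iTX _ _)]
    rw [integral_neg] at h2
    linarith
  have hdec : (∫ z, S.Lf y.v z.1 ∂(q.μ : Measure S.TX)) +
      ∑ j, ∫ z, y.p j z ∂(q.μ : Measure S.TX) ≤ 0 := by
    rw [← integral_finsetSum _ fun j _ => iTX _ _,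
      ← integral_add (f := fun z : S.TX => S.Lf y.v z.1) (iTX _ (S.LfMap v))
        (integrable_finsetSum _ fun j _ => iTX _ _)]
    exact integral_nonpos fun z => hy.decrease z
  have hsum := Finset.sum_le_sum fun j (_ : j ∈ Finset.univ) => hcontrol j
  have hfin : 0 ≤ ∫ x, y.v (S.T, x.1) ∂(q.μT : Measure S.XT) := integral_nonneg hy.v_final
  have hinit : ∫ x, (y.v (0, x.1) + 1) ∂(q.μ₀ : Measure S.X) ≤
      ∫ x, y.w x ∂(q.μ₀ : Measure S.X) :=
    integral_mono (iX _ (sliceMap 0 S.X v + 1)) (iX _ _) hy.w_initial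
  rw [integral_add (f := fun x : S.X => y.v (0, x.1)) (iX _ (sliceMap 0 S.X v))
    (integrable_const _), integral_const, smul_eq_mul, mul_one] at hinit
  have hw : 0 ≤ ∫ x, y.w x ∂(q.μh₀ : Measure S.X) := integral_nonneg hy.w_nonneg
  rw [← hq.lebesgue, integral_add_measure (iX _ _) (iX _ _)]
  linarith

/-! ### Strong duality -/

variable (S) in
/-- The measure program attains the optimal value `d` of the dual program. -/
lemma exists_feasible_mass_eq (hT : 0 < S.T) (hX : IsCompact S.X) (hXT : IsCompact S.XT) {d : ℝ}
    (hd : IsGLB ((fun y : S.DualSpace =>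
      ∫ x, y.2.1 x ∂((volume : Measure (Fin n → ℝ)).comap (Subtype.val : S.X → Fin n → ℝ))) ''
        {y | 0 ≤ S.constraintMap y + S.constraintConst}) d) :
    ∃ q : S.PrimalVar, q.Feasible ∧ (q.μ₀ : Measure S.X).real Set.univ = d := by
  have : CompactSpace S.X := isCompact_iff_compactSpace.1 hX
  have : CompactSpace S.XT := isCompact_iff_compactSpace.1 hXT
  have : CompactSpace S.TX := isCompact_iff_compactSpace.1 (isCompact_Icc.prod hX)
  have := S.isFiniteMeasure_comap_volume hX
  have iX : ∀ (μ : Measure S.X) [IsFiniteMeasure μ] (f : C(S.X, ℝ)), Integrable f μ :=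
    fun μ _ f => integrable_continuousMap _ f
  have iTX : ∀ (μ : Measure S.TX) [IsFiniteMeasure μ] (f : C(S.TX, ℝ)), Integrable f μ :=
    fun μ _ f => integrable_continuousMap _ f
  let c : S.DualSpace →ₗ[ℝ] ℝ :=
    { toFun := fun y =>
        ∫ x, y.2.1 x ∂((volume : Measure (Fin n → ℝ)).comap (Subtype.val : S.X → Fin n → ℝ))
      map_add' := fun y y' => integral_add (iX _ _) (iX _ _)
      map_smul' := fun k y => integral_const_mul k _ }
  obtain ⟨Λ, hΛ, hΛG, hΛb⟩ := exists_dual_multiplier S.constraintMap S.constraintConst c d hd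
    (S.exists_constraint_add_nonneg hT hX hXT)
  obtain ⟨Λ1, Λr1, p1, pr1, s1⟩ := exists_positive_functional_prod Λ hΛ
  obtain ⟨Λ2, Λr2, p2, pr2, s2⟩ := exists_positive_functional_prod Λr1 pr1
  obtain ⟨Λ3, Λr3, p3, pr3, s3⟩ := exists_positive_functional_prod Λr2 pr2
  obtain ⟨Λ4, Λr4, p4, pr4, s4⟩ := exists_positive_functional_prod Λr3 pr3
  obtain ⟨Λ5, Λr5, p5, pr5, s5⟩ := exists_positive_functional_prod Λr4 pr4
  obtain ⟨Λ6, Λ7, p6, p7, s6⟩ := exists_positive_functional_prod Λr5 pr5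
  obtain ⟨μ, hμ⟩ := exists_finiteMeasure_integral_eq Λ1 p1
  obtain ⟨σp, hσp⟩ := exists_finiteMeasure_sum_integral_eq Λ2 p2
  obtain ⟨σm, hσm⟩ := exists_finiteMeasure_sum_integral_eq Λ3 p3
  obtain ⟨σh, hσh⟩ := exists_finiteMeasure_sum_integral_eq Λ4 p4
  obtain ⟨μh₀, hμh₀⟩ := exists_finiteMeasure_integral_eq Λ5 p5
  obtain ⟨μ₀, hμ₀⟩ := exists_finiteMeasure_integral_eq Λ6 p6
  obtain ⟨μT, hμT⟩ := exists_finiteMeasure_integral_eq Λ7 p7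
  -- The identity `c = Λ ∘ G`, split into the components of `Λ`.
  have key : ∀ y : S.DualSpace, c y =
      Λ1 (-(S.LfMap y.1 + ∑ j, y.2.2 j)) + (Λ2 (fun j => y.2.2 j - S.LgMap j y.1) +
        (Λ3 (fun j => y.2.2 j + S.LgMap j y.1) + (Λ4 y.2.2 + (Λ5 y.2.1 +
          (Λ6 (y.2.1 - sliceMap 0 S.X y.1) + Λ7 (sliceMap S.T S.XT y.1)))))) := by
    intro y
    rw [← hΛG y, ← s6, ← s5, ← s4, ← s3, ← s2, ← s1]
    rfl
  -- Test `key` at `(v, 0, 0)`, at `(0, 0, p)` with one nonzero component of `p`, and at `(0, w, 0)`.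
  refine ⟨⟨σp, σm, σh, μ, μ₀, μh₀, μT⟩, ⟨?_, ?_, ?_⟩, ?_⟩
  · intro v hv
    have h := key (⟨v, hv⟩, 0, 0)
    have hc : c (⟨v, hv⟩, 0, 0) = 0 := integral_zero _ _
    simp only [hc, Pi.zero_apply, Finset.sum_const_zero, add_zero, zero_sub, zero_add, map_zero,
      hμ, hσp, hσm, hμ₀, hμT, ContinuousMap.neg_apply, LfMap_apply, LgMap_apply,
      sliceMap_apply, integral_neg, Finset.sum_neg_distrib] at h
    simp only [Finset.sum_sub_distrib]
    linarith
  · intro j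
    apply FiniteMeasure.toMeasure_injective
    rw [FiniteMeasure.toMeasure_add, FiniteMeasure.toMeasure_add]
    refine measure_ext_of_continuousMap fun f => ?_
    have h := key (0, 0, Pi.single j f)
    have hs : ∀ σ : Fin m → FiniteMeasure S.TX,
        ∑ i, ∫ x, (Pi.single j f : Fin m → C(S.TX, ℝ)) i x ∂(σ i : Measure S.TX) =
          ∫ x, f x ∂(σ j : Measure S.TX) := fun σ => by
      rw [Finset.sum_eq_single j (fun i _ hij => by simp [Pi.single_eq_of_ne hij]) (by simp),
        Pi.single_eq_same]
    have hc : c (0, 0, Pi.single j f) = 0 := integral_zero _ _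
    simp only [hc, map_zero, sub_zero, add_zero, zero_add, Fintype.sum_pi_single', hμ,
      hσp, hσm, hσh, hs, ContinuousMap.neg_apply, integral_neg] at h
    rw [integral_add_measure ((iTX _ _).add_measure (iTX _ _)) (iTX _ _),
      integral_add_measure (iTX _ _) (iTX _ _)]
    linarith
  · refine measure_ext_of_continuousMap fun f => ?_
    have h := key (0, f, 0)
    have hc : c (0, f, 0) = ∫ x, f x ∂((volume : Measure (Fin n → ℝ)).comap Subtype.val) := rfl
    simp only [hc, map_zero, sub_zero, add_zero, zero_add, Pi.zero_apply, Finset.sum_const_zero,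
      neg_zero, hμh₀, hμ₀] at h
    have h2 : Λ2 (fun _ => 0) = 0 := map_zero Λ2
    have h3 : Λ3 (fun _ => 0) = 0 := map_zero Λ3
    rw [integral_add_measure (iX _ _) (iX _ _)]
    linarith
  · -- The mass of `μ₀` is read off from `Λ b = -d`, as `b` is `-1` in the component of `μ₀`.
    have h : Λ S.constraintConst = Λ1 0 + (Λ2 0 + (Λ3 0 + (Λ4 0 + (Λ5 0 + (Λ6 (-1) + Λ7 0))))) := by
      rw [← s6, ← s5, ← s4, ← s3, ← s2, ← s1]
      rfl
    have h1 : Λ6 1 = (μ₀ : Measure S.X).real Set.univ := by simp [hμ₀]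
    rw [hΛb, map_neg Λ6, h1] at h
    simp only [map_zero, zero_add, add_zero] at h
    exact (neg_inj.1 h).symm

end ControlAffineData

theorem mainTheorem8 {n m : ℕ} (S : ControlAffineData n m) (hT : 0 < S.T)
    (hX : IsCompact S.X) (hXT : IsCompact S.XT) :
    S.primalValue = S.dualValue := by
  refine le_antisymm (iSup_le fun q => le_iInf fun y => EReal.coe_le_coe_iff.2
    (ControlAffineData.weak_duality hX hXT q.2 y.2)) ?_
  let c : S.DualSpace → ℝ := fun y =>
    ∫ x, y.2.1 x ∂((volume : Measure (Fin n → ℝ)).comap (Subtype.val : S.X → Fin n → ℝ))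
  let F : Set S.DualSpace := {y | 0 ≤ S.constraintMap y + S.constraintConst}
  have hne : F.Nonempty := S.exists_constraint_add_nonneg hT hX hXT S.constraintConst
  have hbdd : BddBelow (c '' F) := by
    refine ⟨0, ?_⟩
    rintro _ ⟨y, hy, rfl⟩
    exact integral_nonneg (ControlAffineData.feasible_of_constraint hy).w_nonneg
  have hd := isGLB_csInf (hne.image c) hbdd
  obtain ⟨q, hq, hqd⟩ := S.exists_feasible_mass_eq hT hX hXT hd
  refine le_trans ?_ (le_iSup (fun q : {q : S.PrimalVar // q.Feasible} =>
    (((q.1.μ₀ : Measure S.X).real Set.univ : ℝ) : EReal)) ⟨q, hq⟩)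
  simp only [hqd]
  -- A real number strictly between `d` and the dual value is beaten by some feasible triple.
  by_contra! hlt
  obtain ⟨r, hr1, hr2⟩ := EReal.lt_iff_exists_real_btwn.1 hlt
  obtain ⟨_, ⟨y, hy, rfl⟩, hyr⟩ := (isGLB_lt_iff hd).1 (EReal.coe_lt_coe_iff.1 hr1)
  have : S.dualValue ≤ (c y : EReal) :=
    iInf_le (fun y : {y : S.DualVar // y.Feasible} =>
      ((∫ x, y.1.w x ∂((volume : Measure (Fin n → ℝ)).comap Subtype.val) : ℝ) : EReal))
      ⟨ControlAffineData.dualVarOf y, ControlAffineData.feasible_of_constraint hy⟩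
  exact absurd (hr2.trans_le this) (not_lt.2 (EReal.coe_le_coe_iff.2 hyr.le))
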